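/- Let $\varepsilon>0$. For $k\ge 1$ let $|\psi\rangle$ be a uniformly random pure state of $k$ qubits, i.e. a unit vector of $(\mathbb{C}^2)^{\otimes k}$ distributed according to the unitarily invariant probability measure on the unit sphere. A $k$-qubit product state is a vector $|\varphi\rangle=|\varphi_1\rangle\otimes\cdots\otimes|\varphi_k\rangle$ with unit vectors $|\varphi_i\rangle\in\mathbb{C}^2$, and its overlap with $|\psi\rangle$ is $|\langle\varphi|\psi\rangle|^2$. Then for every number of qubits $k\ge 40$, $$\Pr_\psi\Big[\text{there is a $k$-qubit product state } |\varphi\rangle \text{ with } |\langle\varphi|\psi\rangle|^2\ \ge\ \frac{k^{1+2\varepsilon}\,2^{-k}}{e}\Big]\ \le\ \left(\frac{1}{\varepsilon^{1+1/\varepsilon}\,k}\right)^{k}.$$ Moreover, for fixed $\varepsilon$ and $k\to\infty$ the bound on the right-hand side behaves like $k^{-k}$ to leading order in the exponent: its logarithm divided by $-k\log k$ tends to $1$. -/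

import Mathlib

open MeasureTheory


noncomputable section

/-- The Hilbert space `(ℂ²)^{⊗ k}` of `k` qubits, in the computational basis
`|x₁, …, x_k⟩`, `x ∈ {0,1}^k`. -/
abbrev QubitSpace (k : ℕ) : Type := EuclideanSpace ℂ (Fin k → Fin 2)

/-- Pure states of `k` qubits: unit vectors of `(ℂ²)^{⊗ k}`. -/
abbrev PureState (k : ℕ) : Type := Metric.sphere (0 : QubitSpace k) 1

/-- The tensor product `φ₁ ⊗ ⋯ ⊗ φ_k` of `k` single-qubit vectors: its coordinate at
`x ∈ {0,1}^k` is `∏ i, φ_i(x_i)`. -/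
def tensorVec {k : ℕ} (φ : Fin k → EuclideanSpace ℂ (Fin 2)) : QubitSpace k :=
  WithLp.toLp 2 fun x => ∏ i, φ i (x i)

theorem norm_tensorVec {k : ℕ} (φ : Fin k → EuclideanSpace ℂ (Fin 2)) :
    ‖tensorVec φ‖ = ∏ i, ‖φ i‖ := by
  have h : ‖tensorVec φ‖ ^ 2 = (∏ i, ‖φ i‖) ^ 2 := by
    rw [EuclideanSpace.norm_sq_eq, ← Finset.prod_pow]
    simp only [EuclideanSpace.norm_sq_eq, tensorVec, norm_prod, ← Finset.prod_pow]
    rw [Finset.prod_univ_sum, Fintype.piFinset_univ]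
  exact (pow_left_inj₀ (norm_nonneg _) (Finset.prod_nonneg fun i _ => norm_nonneg _)
    two_ne_zero).1 h

/-- A pure state is a product state if it is `φ₁ ⊗ ⋯ ⊗ φ_k` for unit vectors `φ_i ∈ ℂ²`. -/
def IsProductState {k : ℕ} (φ : PureState k) : Prop :=
  ∃ v : Fin k → EuclideanSpace ℂ (Fin 2), (∀ i, ‖v i‖ = 1) ∧ (φ : QubitSpace k) = tensorVec v

/-- The overlap `tr(|φ⟩⟨φ| |ψ⟩⟨ψ|) = |⟨φ|ψ⟩|²` of two pure states. -/
def overlap {k : ℕ} (φ ψ : PureState k) : ℝ :=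
  ‖inner ℂ (φ : QubitSpace k) (ψ : QubitSpace k)‖ ^ 2

/-- The law of a (uniformly) random pure state of `k` qubits: the surface measure of the unit
sphere of `(ℂ²)^{⊗ k}`, normalized to be a probability measure. -/
def randomPureState (k : ℕ) : Measure (PureState k) :=
  ((volume : Measure (QubitSpace k)).toSphere Set.univ)⁻¹ •
    (volume : Measure (QubitSpace k)).toSphere

instance (k : ℕ) : IsProbabilityMeasure (randomPureState k) := by
  constructor
  have h0 : (volume : Measure (QubitSpace k)).toSphere Set.univ ≠ 0 := by
    rw [Measure.measure_univ_ne_zero]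
    exact Measure.toSphere_ne_zero _
  rw [randomPureState, Measure.smul_apply, smul_eq_mul,
    ENNReal.inv_mul_cancel h0 (measure_ne_top _ _)]

/-- The action of a unitary operator on pure states. -/
def PureState.map {k : ℕ} (U : QubitSpace k ≃ₗᵢ[ℂ] QubitSpace k) (ψ : PureState k) :
    PureState k :=
  ⟨U ψ, by simp⟩

theorem PureState.continuous_map {k : ℕ} (U : QubitSpace k ≃ₗᵢ[ℂ] QubitSpace k) :
    Continuous (PureState.map U) :=
  (U.continuous.comp continuous_subtype_val).subtype_mk _

open scoped Pointwise in
/-- The law of a random pure state is unitarily invariant. -/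
theorem measurePreserving_randomPureState {k : ℕ} (U : QubitSpace k ≃ₗᵢ[ℂ] QubitSpace k) :
    MeasurePreserving (PureState.map U) (randomPureState k) (randomPureState k) := by
  refine ⟨(PureState.continuous_map U).measurable, ?_⟩
  rw [randomPureState, Measure.map_smul]
  congr 1
  ext s hs
  have hm := (PureState.continuous_map U).measurable
  let V : QubitSpace k ≃ₗᵢ[ℝ] QubitSpace k :=
    { U.toLinearEquiv.restrictScalars ℝ with norm_map' := U.norm_map }
  have hV : MeasurePreserving V volume volume := V.measurePreserving
  have key : V ⁻¹' (Set.Ioo (0 : ℝ) 1 • ((↑) '' s : Set (QubitSpace k))) =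
      Set.Ioo (0 : ℝ) 1 • ((↑) '' (PureState.map U ⁻¹' s) : Set (QubitSpace k)) := by
    ext y
    simp only [Set.mem_smul, Set.mem_image, Set.mem_preimage]
    constructor
    · rintro ⟨r, hr, _, ⟨ψ, hψ, rfl⟩, h⟩
      refine ⟨r, hr, _, ⟨PureState.map U.symm ψ, ?_, rfl⟩, ?_⟩
      · have : PureState.map U (PureState.map U.symm ψ) = ψ := by
          ext1; simp [PureState.map]
        rwa [this]
      · apply V.injective
        refine (map_smul V r _).trans (Eq.trans ?_ h)
        congr 1
        exact U.apply_symm_apply _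
    · rintro ⟨r, hr, _, ⟨ψ, hψ, rfl⟩, rfl⟩
      exact ⟨r, hr, _, ⟨_, hψ, rfl⟩, (map_smul V r _).symm⟩
  rw [Measure.map_apply hm hs, Measure.toSphere_apply' _ hs, Measure.toSphere_apply' _ (hm hs),
    ← key]
  congr 1
  exact hV.measure_preimage_equiv (f := V.toHomeomorph.toMeasurableEquiv) _

end

/-! The proof is a moment method that needs no net. Fix `ψ` and a moment `m`. In each single factor,
|⟨φ|ψ⟩|^{2m} has the form |⟨y, w⟩|^{2m} with `w` in ℂ², so its maximum over unit `y` is m+1 times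
its mean. Treating the `k` factors in turn, the largest value over product states is at most (m+1)^k
times the average over independent uniform factors (`ofReal_norm_inner_tensorVec_pow_le`).

By Fubini it remains to average over `ψ` for a fixed product state. There the moment is m!
Γ(d)/Γ(d+m) ≤ m!/d^m with d = 2^k (`integral_uniformSphere_norm_inner_pow`), and Markov's inequality
yields (m+1)^k m!/(2^k τ)^m for a threshold τ.

Finally `m` is taken near 4k/(3ε) and Stirling's bound is applied (`moment_bound_le`). If the
claimed bound is at least 1 or the threshold exceeds 1, there is nothing to prove; excluding these
cases supplies the inequalities relating ε and `k`. -/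

/-! ### Moments of a linear functional on a complex sphere, via Gaussian integrals. -/

/-- The normalized surface measure of the unit sphere of `ℂ^ι`. -/
noncomputable def uniformSphere (ι : Type*) [Fintype ι] :
    Measure (Metric.sphere (0 : EuclideanSpace ℂ ι) 1) :=
  ((volume : Measure (EuclideanSpace ℂ ι)).toSphere Set.univ)⁻¹ •
    (volume : Measure (EuclideanSpace ℂ ι)).toSphere

instance (ι : Type*) [Fintype ι] [Nonempty ι] : IsProbabilityMeasure (uniformSphere ι) := by
  constructor
  have h0 : (volume : Measure (EuclideanSpace ℂ ι)).toSphere Set.univ ≠ 0 := by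
    rw [Measure.measure_univ_ne_zero]
    exact Measure.toSphere_ne_zero _
  rw [uniformSphere, Measure.smul_apply, smul_eq_mul,
    ENNReal.inv_mul_cancel h0 (measure_ne_top _ _)]

/-- The Gaussian integral of a positively homogeneous function in polar coordinates. -/
theorem integral_homogeneous_mul_exp_neg_sq {E : Type*} [NormedAddCommGroup E] [NormedSpace ℝ E]
    [MeasurableSpace E] [BorelSpace E] [FiniteDimensional ℝ E] [Nontrivial E]
    (μ : Measure E) [μ.IsAddHaarMeasure] (f : E → ℝ) (n : ℕ)
    (hf : ∀ (r : ℝ) (x : E), 0 < r → f (r • x) = r ^ n * f x) :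
    ∫ x, f x * Real.exp (-‖x‖ ^ 2) ∂μ =
      (∫ u, f u ∂μ.toSphere) * (Real.Gamma ((n + Module.finrank ℝ E) / 2) / 2) := by
  have hpos : 0 < Module.finrank ℝ E := Module.finrank_pos
  calc
    ∫ x, f x * Real.exp (-‖x‖ ^ 2) ∂μ =
        ∫ x : ({(0)}ᶜ : Set E), f x * Real.exp (-‖x.1‖ ^ 2) ∂(μ.comap (↑)) := by
      rw [integral_subtype_comap (measurableSet_singleton _).compl
        fun x => f x * Real.exp (-‖x‖ ^ 2), restrict_compl_singleton]
    _ = ∫ p : Metric.sphere (0 : E) 1 × Set.Ioi (0 : ℝ),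
          f p.1 * (p.2.1 ^ n * Real.exp (-p.2.1 ^ 2))
          ∂μ.toSphere.prod (.volumeIoiPow (Module.finrank ℝ E - 1)) := by
      rw [← μ.measurePreserving_homeomorphUnitSphereProd.integral_comp
        (Homeomorph.measurableEmbedding _)]
      refine integral_congr_ae (.of_forall fun x => ?_)
      have hx : 0 < ‖x.1‖ := norm_pos_iff.2 x.2
      have h : f x.1 = ‖x.1‖ ^ n * f (‖x.1‖⁻¹ • x.1) := by
        rw [← hf _ _ hx, smul_smul, mul_inv_cancel₀ hx.ne', one_smul]
      simp only [homeomorphUnitSphereProd_apply_fst_coe, homeomorphUnitSphereProd_apply_snd_coe]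
      rw [h]
      ring
    _ = (∫ u, f u ∂μ.toSphere) * ∫ r : Set.Ioi (0 : ℝ), r.1 ^ n * Real.exp (-r.1 ^ 2)
          ∂.volumeIoiPow (Module.finrank ℝ E - 1) :=
      integral_prod_mul (fun u : Metric.sphere (0 : E) 1 => f u)
        (fun r : Set.Ioi (0 : ℝ) => r.1 ^ n * Real.exp (-r.1 ^ 2))
    _ = _ := by
      congr 1
      -- The radial density contributes r^(dim - 1); the natural subtraction is harmless because dim
      -- > 0.
      have h := integral_rpow_mul_exp_neg_rpow (p := 2)
        (q := ((n + (Module.finrank ℝ E - 1) : ℕ) : ℝ)) two_pos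
        (lt_of_lt_of_le (by norm_num) (Nat.cast_nonneg _))
      have hq : ((n + (Module.finrank ℝ E - 1) : ℕ) : ℝ) + 1 = n + Module.finrank ℝ E := by
        rw [Nat.cast_add, Nat.cast_sub hpos]; push_cast; ring
      rw [hq] at h
      simp only [Measure.volumeIoiPow, ENNReal.ofReal]
      rw [integral_withDensity_eq_integral_smul
        ((measurable_subtype_coe.pow_const _).real_toNNReal),
        integral_subtype_comap measurableSet_Ioi fun a : ℝ =>
          Real.toNNReal (a ^ (Module.finrank ℝ E - 1)) • (a ^ n * Real.exp (-a ^ 2))]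
      refine Eq.trans (setIntegral_congr_fun measurableSet_Ioi fun x hx => ?_) (h.trans (by ring))
      simp only [NNReal.smul_def, Real.coe_toNNReal _ (pow_nonneg (le_of_lt hx) _),
        Real.rpow_natCast, Real.rpow_two, smul_eq_mul, pow_add]
      ring

theorem Complex.integral_norm_pow_mul_exp_neg_sq (m : ℕ) :
    ∫ z : ℂ, ‖z‖ ^ (2 * m) * Real.exp (-‖z‖ ^ 2) = Real.pi * m.factorial := by
  have h := Complex.integral_rpow_mul_exp_neg_rpow (p := 2) (q := (2 * m : ℕ)) one_le_two
    (lt_of_lt_of_le (by norm_num) (Nat.cast_nonneg _))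
  have e : (((2 * m : ℕ) : ℝ) + 2) / 2 = m + 1 := by push_cast; ring
  simp only [Real.rpow_natCast, Real.rpow_two] at h
  rw [h, e, Real.Gamma_nat_eq_factorial]
  ring

theorem EuclideanSpace.exists_volume_eq_smul_map_toLp (ι : Type*) [Fintype ι] :
    ∃ c : NNReal, c ≠ 0 ∧ (volume : Measure (EuclideanSpace ℂ ι)) =
      c • (volume : Measure (ι → ℂ)).map (MeasurableEquiv.toLp 2 (ι → ℂ)) := by
  have : ((volume : Measure (ι → ℂ)).map (MeasurableEquiv.toLp 2 (ι → ℂ))).IsAddHaarMeasure := by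
    rw [MeasurableEquiv.coe_toLp, ← PiLp.coe_symm_continuousLinearEquiv 2 ℝ]
    exact ContinuousLinearEquiv.isAddHaarMeasure_map
      (PiLp.continuousLinearEquiv 2 ℝ (fun _ : ι => ℂ)).symm _
  refine ⟨Measure.addHaarScalarFactor _ _, ?_, Measure.isAddLeftInvariant_eq_smul _ _⟩
  exact (Measure.addHaarScalarFactor_pos_of_isAddHaarMeasure _ _).ne'

/-- The Gaussian weight factors over coordinates. The value of `C` is immaterial, only its
independence of `m` matters: it cancels against the case m = 0. -/
theorem EuclideanSpace.exists_integral_norm_coord_pow_mul_exp_neg_sq (ι : Type*) [Fintype ι]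
    (i : ι) : ∃ C : ℝ, C ≠ 0 ∧ ∀ m : ℕ,
      ∫ z : EuclideanSpace ℂ ι, ‖z i‖ ^ (2 * m) * Real.exp (-‖z‖ ^ 2) = C * m.factorial := by
  classical
  obtain ⟨c, hc, hv⟩ := exists_volume_eq_smul_map_toLp ι
  refine ⟨c * Real.pi ^ Fintype.card ι, by positivity, fun m => ?_⟩
  have key : ∀ z : ι → ℂ, ‖z i‖ ^ (2 * m) * Real.exp (-‖WithLp.toLp 2 z‖ ^ 2) =
      ∏ j, (‖z j‖ ^ (2 * if j = i then m else 0) * Real.exp (-‖z j‖ ^ 2)) := by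
    intro z
    rw [EuclideanSpace.norm_sq_eq, Finset.prod_mul_distrib, ← Real.exp_sum,
      Finset.sum_neg_distrib, Finset.prod_eq_single i]
    · simp
    · intro j _ hj
      simp [hj]
    · simp
  rw [hv, integral_smul_nnreal_measure, integral_map_equiv]
  simp only [MeasurableEquiv.coe_toLp, key]
  rw [integral_fintype_prod_volume_eq_prod
    (f := fun j (w : ℂ) => ‖w‖ ^ (2 * if j = i then m else 0) * Real.exp (-‖w‖ ^ 2))]
  simp only [Complex.integral_norm_pow_mul_exp_neg_sq]
  rw [Finset.prod_mul_distrib, Finset.prod_const, Finset.card_univ, Finset.prod_eq_single i]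
  · rw [NNReal.smul_def, smul_eq_mul]
    simp
    ring
  · intro j _ hj
    simp [hj]
  · simp

theorem exists_linearIsometryEquiv_inner_eq_coord {ι : Type*} [Fintype ι] (i : ι)
    (v : EuclideanSpace ℂ ι) (hv : ‖v‖ = 1) :
    ∃ U : EuclideanSpace ℂ ι ≃ₗᵢ[ℂ] EuclideanSpace ℂ ι, ∀ z, inner ℂ v z = U z i := by
  obtain ⟨b, hb⟩ := Orthonormal.exists_orthonormalBasis_extension_of_card_eq
    (𝕜 := ℂ) (E := EuclideanSpace ℂ ι) (ι := ι) (by simp) (v := fun _ => v) (s := {i})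
    ⟨fun _ => hv, fun a b hab => (hab (Subsingleton.elim a b)).elim⟩
  exact ⟨b.repr, fun z => by rw [b.repr_apply_apply, hb i rfl]⟩

theorem exists_integral_norm_inner_pow_mul_exp_neg_sq (ι : Type*) [Fintype ι] [Nonempty ι] :
    ∃ C : ℝ, C ≠ 0 ∧ ∀ v : EuclideanSpace ℂ ι, ‖v‖ = 1 → ∀ m : ℕ,
      ∫ z : EuclideanSpace ℂ ι, ‖inner ℂ z v‖ ^ (2 * m) * Real.exp (-‖z‖ ^ 2) =
        C * m.factorial := by
  obtain ⟨i⟩ := ‹Nonempty ι›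
  obtain ⟨C, hC, h⟩ := EuclideanSpace.exists_integral_norm_coord_pow_mul_exp_neg_sq ι i
  refine ⟨C, hC, fun v hv m => ?_⟩
  obtain ⟨U, hU⟩ := exists_linearIsometryEquiv_inner_eq_coord i v hv
  let V : EuclideanSpace ℂ ι ≃ₗᵢ[ℝ] EuclideanSpace ℂ ι :=
    { U.toLinearEquiv.restrictScalars ℝ with norm_map' := U.norm_map }
  have hV : MeasurePreserving V volume volume := V.measurePreserving
  rw [← h m, ← hV.integral_comp V.toHomeomorph.measurableEmbedding
    (fun z => ‖z i‖ ^ (2 * m) * Real.exp (-‖z‖ ^ 2))]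
  refine integral_congr_ae (.of_forall fun z => ?_)
  have h1 : V z i = U z i := rfl
  simp only [h1, ← hU, V.norm_map, norm_inner_symm z v]

/-- Polar coordinates turn the Gaussian moment into the spherical one; dividing by the case m = 0
removes both `C` and the area of the sphere. -/
theorem integral_uniformSphere_norm_inner_pow {ι : Type*} [Fintype ι] [Nonempty ι]
    (v : EuclideanSpace ℂ ι) (m : ℕ) :
    ∫ u : Metric.sphere (0 : EuclideanSpace ℂ ι) 1,
        ‖inner ℂ (u : EuclideanSpace ℂ ι) v‖ ^ (2 * m) ∂uniformSphere ι =
      ‖v‖ ^ (2 * m) * (m.factorial * Real.Gamma (Fintype.card ι) /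
        Real.Gamma (Fintype.card ι + m)) := by
  have hd : 0 < (Fintype.card ι : ℝ) := Nat.cast_pos.2 Fintype.card_pos
  have hG0 := (Real.Gamma_pos_of_pos hd).ne'
  have hGm := (Real.Gamma_pos_of_pos (add_pos_of_pos_of_nonneg hd (Nat.cast_nonneg m))).ne'
  have main : ∀ w : EuclideanSpace ℂ ι, ‖w‖ = 1 →
      ∫ u : Metric.sphere (0 : EuclideanSpace ℂ ι) 1,
        ‖inner ℂ (u : EuclideanSpace ℂ ι) w‖ ^ (2 * m) ∂uniformSphere ι =
      m.factorial * Real.Gamma (Fintype.card ι) / Real.Gamma (Fintype.card ι + m) := by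
    intro w hw
    obtain ⟨C, hC, h⟩ := exists_integral_norm_inner_pow_mul_exp_neg_sq ι
    have hdim : (Module.finrank ℝ (EuclideanSpace ℂ ι) : ℝ) = 2 * Fintype.card ι := by
      rw [← Module.finrank_mul_finrank ℝ ℂ (EuclideanSpace ℂ ι)]
      simp
    have polar : ∀ m : ℕ, C * m.factorial =
        (∫ u : Metric.sphere (0 : EuclideanSpace ℂ ι) 1,
          ‖inner ℂ (u : EuclideanSpace ℂ ι) w‖ ^ (2 * m)
          ∂(volume : Measure (EuclideanSpace ℂ ι)).toSphere) *
        (Real.Gamma (Fintype.card ι + m) / 2) := by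
      intro m
      rw [← h w hw m, integral_homogeneous_mul_exp_neg_sq volume
        (fun z : EuclideanSpace ℂ ι => ‖inner ℂ z w‖ ^ (2 * m)) (2 * m), hdim]
      · congr 3
        push_cast
        ring
      · intro r x hr
        rw [← Complex.coe_smul, inner_smul_left, norm_mul, mul_pow]
        simp [abs_of_pos hr]
    have hm := polar m
    have h0 := polar 0
    simp only [mul_zero, pow_zero, integral_const, smul_eq_mul, mul_one, Nat.factorial_zero,
      Nat.cast_one, Nat.cast_zero, add_zero] at h0
    rw [uniformSphere, integral_smul_measure, ENNReal.toReal_inv, smul_eq_mul, ← measureReal_def]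
    have hS : (volume : Measure (EuclideanSpace ℂ ι)).toSphere.real Set.univ ≠ 0 := by
      intro h
      rw [h, zero_mul] at h0
      exact hC h0
    rw [h0] at hm
    field_simp at hm ⊢
    linear_combination -hm
  rcases eq_or_ne v 0 with rfl | hv
  · rcases eq_or_ne m 0 with rfl | hm
    · simp [hG0]
    · simp [hm]
  · have hv' : ‖v‖ ≠ 0 := norm_ne_zero_iff.2 hv
    have hw := main (((‖v‖⁻¹ : ℝ) : ℂ) • v) (by simp [norm_smul, hv'])
    rw [← hw, ← integral_const_mul]
    refine integral_congr_ae (.of_forall fun u => ?_)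
    simp only
    rw [inner_smul_right, norm_mul, ← mul_pow, ← mul_assoc]
    simp [hv']

/-! ### From the largest overlap to the average one. -/

/-- For d = 2 the moment is ‖w‖^(2m)/(m+1), and Cauchy–Schwarz bounds the left side by ‖w‖^(2m). -/
theorem norm_inner_pow_le_card_mul_integral (w : EuclideanSpace ℂ (Fin 2)) (m : ℕ)
    (u : Metric.sphere (0 : EuclideanSpace ℂ (Fin 2)) 1) :
    ‖inner ℂ (u : EuclideanSpace ℂ (Fin 2)) w‖ ^ (2 * m) ≤
      (m + 1) * ∫ y : Metric.sphere (0 : EuclideanSpace ℂ (Fin 2)) 1,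
        ‖inner ℂ (y : EuclideanSpace ℂ (Fin 2)) w‖ ^ (2 * m) ∂uniformSphere (Fin 2) := by
  have hu : ‖(u : EuclideanSpace ℂ (Fin 2))‖ = 1 := norm_eq_of_mem_sphere u
  have h1 : Real.Gamma ((Fintype.card (Fin 2) : ℕ) : ℝ) = 1 := by
    simp
  have h2 : Real.Gamma ((Fintype.card (Fin 2) : ℕ) + m : ℝ) = (m + 1) * m.factorial := by
    have h : ((Fintype.card (Fin 2) : ℕ) + m : ℝ) = ((m + 1 : ℕ) : ℝ) + 1 := by
      rw [Fintype.card_fin]; push_cast; ring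
    rw [h, Real.Gamma_nat_eq_factorial, Nat.factorial_succ]
    push_cast
    ring
  rw [integral_uniformSphere_norm_inner_pow, h1, h2]
  have hm : (m + 1 : ℝ) ≠ 0 := by positivity
  have hf : (m.factorial : ℝ) ≠ 0 := by positivity
  have e : (m + 1 : ℝ) * (‖w‖ ^ (2 * m) * (m.factorial * 1 / ((m + 1) * m.factorial))) =
      ‖w‖ ^ (2 * m) := by
    field_simp
  rw [e]
  gcongr
  simpa [hu] using norm_inner_le_norm (𝕜 := ℂ) (u : EuclideanSpace ℂ (Fin 2)) w

/-- Γ(d+m)/Γ(d) is a product of `m` factors, each at least `d`. -/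
theorem factorial_mul_Gamma_div_Gamma_add_le {d : ℕ} (hd : 0 < d) (m : ℕ) :
    m.factorial * Real.Gamma d / Real.Gamma (d + m) ≤ m.factorial / (d : ℝ) ^ m := by
  obtain ⟨d, rfl⟩ := Nat.exists_eq_succ_of_ne_zero hd.ne'
  have h1 : Real.Gamma ((d.succ : ℕ) : ℝ) = d.factorial := by
    rw [← Real.Gamma_nat_eq_factorial]; push_cast; rfl
  have h2 : Real.Gamma ((d.succ : ℕ) + m : ℝ) = (d + m).factorial := by
    rw [← Real.Gamma_nat_eq_factorial]; push_cast; ring_nf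
  have h3 : (d.factorial : ℝ) * ((d.succ : ℕ) : ℝ) ^ m ≤ (d + m).factorial := by
    exact_mod_cast Nat.factorial_mul_pow_le_factorial
  rw [h1, h2, div_le_div_iff₀ (by positivity) (by positivity), mul_assoc]
  gcongr

/-- The tensor product is linear in each factor: its inner product with a fixed vector is, as a
function of one factor, the inner product with a fixed single-qubit vector. -/
theorem exists_inner_tensorVec_update {k : ℕ} (φ : Fin k → EuclideanSpace ℂ (Fin 2))
    (ψ : QubitSpace k) (i : Fin k) : ∃ w : EuclideanSpace ℂ (Fin 2),
      ∀ y, inner ℂ (tensorVec (Function.update φ i y)) ψ = inner ℂ y w := by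
  -- The witness is the partial contraction of `ψ` with all factors but the `i`-th, conjugated as in
  -- the first slot of `inner`.
  refine ⟨WithLp.toLp 2 fun b => ∑ x : Fin k → Fin 2, if x i = b then
    ψ x * ∏ j ∈ Finset.univ.erase i, (starRingEnd ℂ) (φ j (x j)) else 0, fun y => ?_⟩
  simp only [PiLp.inner_apply, RCLike.inner_apply, tensorVec, Finset.sum_mul, ite_mul, zero_mul]
  rw [Finset.sum_comm]
  refine Finset.sum_congr rfl fun x _ => ?_
  rw [Finset.sum_ite_eq, if_pos (Finset.mem_univ _),
    ← Finset.mul_prod_erase _ _ (Finset.mem_univ i), map_mul, map_prod, Function.update_self]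
  have : ∏ j ∈ Finset.univ.erase i, (starRingEnd ℂ) (Function.update φ i y j (x j)) =
      ∏ j ∈ Finset.univ.erase i, (starRingEnd ℂ) (φ j (x j)) :=
    Finset.prod_congr rfl fun j hj => by rw [Function.update_of_ne (Finset.ne_of_mem_erase hj)]
  rw [this]
  ring

/-- Coordinates are integrated out one at a time, each at the cost of a factor `C`. -/
theorem le_pow_mul_lmarginal {ι : Type*} [DecidableEq ι] {X : ι → Type*}
    [∀ i, MeasurableSpace (X i)] (μ : ∀ i, Measure (X i)) [∀ i, SigmaFinite (μ i)]
    {f : (∀ i, X i) → ENNReal} (hf : Measurable f) (C : ENNReal)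
    (h : ∀ i x, f x ≤ C * ∫⁻ y, f (Function.update x i y) ∂μ i) (s : Finset ι) (x : ∀ i, X i) :
    f x ≤ C ^ s.card * lmarginal μ s f x := by
  induction s using Finset.induction_on generalizing x with
  | empty => simp
  | insert i s hi ih =>
    rw [lmarginal_insert f hf hi, Finset.card_insert_of_notMem hi, pow_succ', mul_assoc]
    refine (h i x).trans ?_
    gcongr
    exact (lintegral_mono fun y => ih _).trans_eq
      (lintegral_const_mul _ ((hf.lmarginal μ).comp (measurable_update x)))

/-- Unit vectors of the single-qubit space. -/
abbrev QubitSphere : Type := Metric.sphere (0 : EuclideanSpace ℂ (Fin 2)) 1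

theorem continuous_inner_tensorVec (k : ℕ) :
    Continuous fun p : (Fin k → QubitSphere) × PureState k =>
      inner ℂ (tensorVec fun i => (p.1 i : EuclideanSpace ℂ (Fin 2))) (p.2 : QubitSpace k) := by
  simp only [PiLp.inner_apply, RCLike.inner_apply, tensorVec]
  fun_prop

theorem ofReal_norm_inner_tensorVec_pow_le {k : ℕ} (m : ℕ) (ψ : PureState k)
    (φ : Fin k → QubitSphere) :
    ENNReal.ofReal (‖inner ℂ (tensorVec fun i => (φ i : EuclideanSpace ℂ (Fin 2)))
        (ψ : QubitSpace k)‖ ^ (2 * m)) ≤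
      ENNReal.ofReal (m + 1) ^ k * ∫⁻ φ' : Fin k → QubitSphere,
        ENNReal.ofReal (‖inner ℂ (tensorVec fun i => (φ' i : EuclideanSpace ℂ (Fin 2)))
          (ψ : QubitSpace k)‖ ^ (2 * m)) ∂Measure.pi fun _ => uniformSphere (Fin 2) := by
  have hc : Continuous fun φ : Fin k → QubitSphere =>
      ‖inner ℂ (tensorVec fun i => (φ i : EuclideanSpace ℂ (Fin 2))) (ψ : QubitSpace k)‖ ^
        (2 * m) :=
    ((continuous_inner_tensorVec k).comp (Continuous.prodMk_left ψ)).norm.pow _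
  have h := le_pow_mul_lmarginal (fun _ : Fin k => uniformSphere (Fin 2))
    (ENNReal.measurable_ofReal.comp hc.measurable) (ENNReal.ofReal (m + 1)) ?_ Finset.univ φ
  · simpa using h
  intro i φ
  obtain ⟨w, hw⟩ := exists_inner_tensorVec_update
    (fun j => (φ j : EuclideanSpace ℂ (Fin 2))) (ψ : QubitSpace k) i
  have hup : ∀ y : QubitSphere, (fun j => (Function.update φ i y j : EuclideanSpace ℂ (Fin 2))) =
      Function.update (fun j => (φ j : EuclideanSpace ℂ (Fin 2))) i y := by
    intro y
    ext1 j
    rcases eq_or_ne j i with rfl | hj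
    · simp
    · simp [hj]
  -- Viewing `φ` as its own update makes the point value and the integrand use the same `w`.
  have hself : (fun j => (φ j : EuclideanSpace ℂ (Fin 2))) =
      Function.update (fun j => (φ j : EuclideanSpace ℂ (Fin 2))) i (φ i) := by simp
  simp only [Function.comp_apply, hup, hw]
  rw [hself, hw, ← ofReal_integral_eq_lintegral_ofReal, ← ENNReal.ofReal_mul (by positivity)]
  · exact ENNReal.ofReal_le_ofReal (norm_inner_pow_le_card_mul_integral w m (φ i))
  · exact Continuous.integrable_of_hasCompactSupport (by fun_prop)
      (HasCompactSupport.of_compactSpace _)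
  · exact .of_forall fun y => by positivity

/-- Moment bound for the largest overlap of a random state with a product state. -/
theorem randomPureState_real_exists_overlap_ge_le (k m : ℕ) {τ : ℝ} (hτ : 0 < τ) :
    (randomPureState k).real {ψ : PureState k | ∃ φ : PureState k, IsProductState φ ∧
        τ ≤ overlap φ ψ} ≤ (m + 1) ^ k * m.factorial / (2 ^ k * τ) ^ m := by
  set ν : Measure (Fin k → QubitSphere) := Measure.pi fun _ => uniformSphere (Fin 2) with hν
  let F : PureState k → (Fin k → QubitSphere) → ENNReal := fun ψ φ =>
    ENNReal.ofReal (‖inner ℂ (tensorVec fun i => (φ i : EuclideanSpace ℂ (Fin 2)))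
      (ψ : QubitSpace k)‖ ^ (2 * m))
  have hF : Measurable (Function.uncurry F) :=
    ENNReal.measurable_ofReal.comp
      (((continuous_inner_tensorVec k).comp continuous_swap).norm.pow _).measurable
  let G : PureState k → ENNReal := fun ψ => ENNReal.ofReal (m + 1) ^ k * ∫⁻ φ, F ψ φ ∂ν
  have hI : Measurable fun ψ => ∫⁻ φ, F ψ φ ∂ν := hF.lintegral_prod_right
  have hG : Measurable G := hI.const_mul _
  have hsub : {ψ : PureState k | ∃ φ : PureState k, IsProductState φ ∧ τ ≤ overlap φ ψ} ⊆
      {ψ | ENNReal.ofReal (τ ^ m) ≤ G ψ} := by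
    rintro ψ ⟨φ, ⟨v, hv, hφ⟩, hle⟩
    have h := ofReal_norm_inner_tensorVec_pow_le m ψ
      (fun i => (⟨v i, by simp [hv i]⟩ : QubitSphere))
    refine le_trans (ENNReal.ofReal_le_ofReal ?_) h
    rw [overlap, hφ] at hle
    rw [pow_mul]
    exact pow_le_pow_left₀ hτ.le hle m
  have hmoment : ∀ φ : Fin k → QubitSphere,
      ∫⁻ ψ, F ψ φ ∂randomPureState k ≤ ENNReal.ofReal (m.factorial / (2 ^ k) ^ m) := by
    intro φ
    have hn : ‖tensorVec fun i => (φ i : EuclideanSpace ℂ (Fin 2))‖ = 1 := by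
      rw [norm_tensorVec]
      exact Finset.prod_eq_one fun i _ => norm_eq_of_mem_sphere (φ i)
    have h := integral_uniformSphere_norm_inner_pow
      (tensorVec fun i => (φ i : EuclideanSpace ℂ (Fin 2))) m
    rw [hn, one_pow, one_mul] at h
    have hint : ∫ ψ : PureState k, ‖inner ℂ (tensorVec fun i => (φ i : EuclideanSpace ℂ (Fin 2)))
        (ψ : QubitSpace k)‖ ^ (2 * m) ∂randomPureState k =
        m.factorial * Real.Gamma (Fintype.card (Fin k → Fin 2)) /
          Real.Gamma (Fintype.card (Fin k → Fin 2) + m) := by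
      rw [← h]
      exact integral_congr_ae (.of_forall fun ψ => by simp only [norm_inner_symm])
    simp only [F]
    rw [← ofReal_integral_eq_lintegral_ofReal, hint]
    · refine ENNReal.ofReal_le_ofReal
        ((factorial_mul_Gamma_div_Gamma_add_le Fintype.card_pos m).trans (le_of_eq ?_))
      simp
    · exact Continuous.integrable_of_hasCompactSupport (by fun_prop)
        (HasCompactSupport.of_compactSpace _)
    · exact .of_forall fun y => by positivity
  have htotal : ∫⁻ ψ, G ψ ∂randomPureState k ≤
      ENNReal.ofReal ((m + 1) ^ k * (m.factorial / (2 ^ k) ^ m)) := by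
    rw [lintegral_const_mul _ hI, ENNReal.ofReal_mul (by positivity),
      ENNReal.ofReal_pow (by positivity)]
    gcongr
    -- After the swap, `hmoment` bounds the inner integral uniformly in `φ`.
    rw [lintegral_lintegral_swap hF.aemeasurable]
    calc _ ≤ ∫⁻ _ : Fin k → QubitSphere, ENNReal.ofReal (m.factorial / (2 ^ k) ^ m) ∂ν :=
          lintegral_mono hmoment
      _ = _ := by simp
  have hmarkov := mul_meas_ge_le_lintegral (μ := randomPureState k) hG (ENNReal.ofReal (τ ^ m))
  have hle := (mul_le_mul_right (measure_mono hsub) _).trans (hmarkov.trans htotal)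
  rw [← ofReal_measureReal, ← ENNReal.ofReal_mul (by positivity),
    ENNReal.ofReal_le_ofReal_iff (by positivity)] at hle
  rw [mul_pow, le_div_iff₀ (by positivity)]
  calc _ = (2 ^ k) ^ m * (τ ^ m * (randomPureState k).real _) := by ring
    _ ≤ (2 ^ k) ^ m * ((m + 1) ^ k * (m.factorial / (2 ^ k) ^ m)) := by gcongr
    _ = _ := by field_simp

/-! ### Numerical estimates and the choice of the moment. -/

/-- The Stirling sequence decreases from its value e/√2 at n = 1. -/
theorem log_factorial_le {n : ℕ} (hn : n ≠ 0) :
    Real.log n.factorial ≤ 1 + Real.log n / 2 + n * Real.log n - n := by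
  obtain ⟨n, rfl⟩ := Nat.exists_eq_succ_of_ne_zero hn
  have h := Stirling.log_stirlingSeq'_antitone (Nat.zero_le n)
  have hn0 : ((n.succ : ℕ) : ℝ) ≠ 0 := by positivity
  simp only [Function.comp_apply, Nat.succ_eq_add_one, zero_add] at h hn0 ⊢
  rw [Stirling.log_stirlingSeq_formula, Stirling.stirlingSeq_one,
    Real.log_div (Real.exp_pos 1).ne' (by positivity), Real.log_exp,
    Real.log_sqrt zero_le_two, Real.log_mul two_ne_zero hn0,
    Real.log_div hn0 (Real.exp_pos 1).ne', Real.log_exp] at h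
  linarith

/-- This is t ≤ sinh t at t = log(1+u). -/
theorem log_one_add_le {u : ℝ} (hu : 0 ≤ u) :
    Real.log (1 + u) ≤ u * (u + 2) / (2 * (1 + u)) := by
  have h := Real.self_le_sinh_iff.2 (Real.log_nonneg (by linarith : (1 : ℝ) ≤ 1 + u))
  rw [Real.sinh_log (by linarith)] at h
  refine h.trans (le_of_eq ?_)
  field_simp
  ring

theorem log_forty_gt : 3.688 < Real.log 40 := by
  have h1 : Real.log (40 ^ 3) = 3 * Real.log 40 := by rw [Real.log_pow]; norm_num
  have h2 : Real.log (2 ^ 16) = 16 * Real.log 2 := by rw [Real.log_pow]; norm_num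
  -- 40³ = 64000 is close to 2¹⁶ = 65536.
  have h3 := Real.one_sub_inv_le_log_of_pos (x := 40 ^ 3 / 2 ^ 16) (by norm_num)
  rw [Real.log_div (by norm_num) (by norm_num), h1, h2] at h3
  have h4 := Real.log_two_gt_d9
  norm_num at h3
  linarith

/-- 0.37 is close to 1/e, so first-order bounds for log at 0.37·e ≈ 1 suffice. -/
theorem log_point_three_seven_mem :
    -0.9943 < Real.log 0.37 ∧ Real.log 0.37 < -0.994 := by
  have he := Real.exp_one_gt_d9
  have he' := Real.exp_one_lt_d9
  have h : Real.log (0.37 * Real.exp 1) = Real.log 0.37 + 1 := by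
    rw [Real.log_mul (by norm_num) (Real.exp_pos 1).ne', Real.log_exp]
  have h1 := Real.log_le_sub_one_of_pos (x := 0.37 * Real.exp 1) (by positivity)
  have h2 := Real.one_sub_inv_le_log_of_pos (x := 0.37 * Real.exp 1) (by positivity)
  have h3 : (0.37 * Real.exp 1)⁻¹ ≤ 0.99428 :=
    inv_le_of_inv_le₀ (by norm_num) (by norm_num; linarith)
  rw [h] at h1 h2
  constructor <;> linarith

/-- Tangent line of log at 128 = 2⁷. -/
theorem log_le_div_add {m : ℝ} (hm : 0 < m) : Real.log m ≤ m / 128 + 3.853 := by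
  have h := Real.log_le_sub_one_of_pos (x := m / 2 ^ 7) (by positivity)
  rw [Real.log_div hm.ne' (by norm_num), Real.log_pow] at h
  have := Real.log_two_lt_d9
  norm_num at h
  linarith

/-- The slope estimate that absorbs the lower order terms of the moment bound. -/
theorem one_add_half_log_add_le {k ε x m L : ℝ} (hk : 40 ≤ k) (hε : 0 < ε) (hx : x * ε = k)
    (hL : 3.688 ≤ L) (hA : 0 ≤ (1 + ε) * Real.log ε + ε * L)
    (hB : (1 + 2 * ε) * L ≤ 1 + k * Real.log 2) (hm : 4 * x / 3 ≤ m) (hm' : m ≤ 4 * x / 3 + 1) :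
    1 + Real.log m / 2 + ε ≤
      (m - x) * (2 * ε * L + Real.log ε - ε - 1 - (m - x) / x / 2) := by
  have hx0 : 0 < x := by
    by_contra! h
    nlinarith
  have hlog := log_le_div_add (show 0 < m by linarith)
  have hu : (m - x) / x ≤ 1 / 3 + 1 / x := by
    rw [div_le_iff₀ hx0, add_mul, one_div_mul_cancel hx0.ne']
    linarith
  obtain ⟨l1, l2⟩ := log_point_three_seven_mem
  -- For small ε, `hA` gives 2εL + log ε ≥ -(1+2ε) log ε, and the tangent of log at 0.37 bounds this
  -- below. For large ε, L ≥ 3.688 makes the slope grow linearly in ε, and `hB` keeps x = k/ε at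
  -- least 10.
  rcases le_total ε 0.37 with h | h
  · have hx108 : 108 ≤ x := by nlinarith
    have hx' : 1 / x ≤ 1 / 108 := one_div_le_one_div_of_le (by norm_num) hx108
    have hl : 1.994 - ε / 0.37 ≤ -Real.log ε := by
      have := Real.log_le_sub_one_of_pos (x := ε / 0.37) (by positivity)
      rw [Real.log_div hε.ne' (by norm_num)] at this
      linarith
    have hG : 0.359 ≤ 2 * ε * L + Real.log ε - ε - 1 := by
      have h1 : (1 + 2 * ε) * (1.994 - ε / 0.37) ≤ (1 + 2 * ε) * -Real.log ε :=
        mul_le_mul_of_nonneg_left hl (by linarith)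
      have h2 : ε * (ε / 0.37) ≤ ε := by
        have : ε / 0.37 ≤ 1 := (div_le_one (by norm_num)).2 h
        nlinarith
      have h3 : ε / 0.37 ≤ 1 := (div_le_one (by norm_num)).2 h
      norm_num at h1 h2 h3 ⊢
      nlinarith
    have h1 : (x / 3) * 0.187 ≤
        (m - x) * (2 * ε * L + Real.log ε - ε - 1 - (m - x) / x / 2) :=
      mul_le_mul (by linarith) (by norm_num at hG hx' hu ⊢; linarith) (by norm_num) (by linarith)
    norm_num at h1 h hlog ⊢
    linarith
  · have hl : Real.log 0.37 ≤ Real.log ε := Real.log_le_log (by norm_num) h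
    have hεL : ε * 3.688 ≤ ε * L := by gcongr
    have hG : 6.376 * ε - 1.9943 ≤ 2 * ε * L + Real.log ε - ε - 1 := by
      norm_num at hεL hl l1 ⊢
      linarith
    have hk10 : 10 * ε ≤ k := by
      have := Real.log_two_lt_d9
      norm_num at *
      nlinarith
    have hx10 : 10 ≤ x := by nlinarith
    have hx' : 1 / x ≤ 1 / 10 := one_div_le_one_div_of_le (by norm_num) hx10
    have h1 : (x / 3) * (6.376 * ε - 1.9943 - 1 / 6 - 1 / x / 2) ≤
        (m - x) * (2 * ε * L + Real.log ε - ε - 1 - (m - x) / x / 2) := by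
      refine mul_le_mul (by linarith) (by linarith) ?_ (by linarith)
      norm_num at h hx' ⊢
      linarith
    have h2 : (x / 3) * (6.376 * ε - 1.9943 - 1 / 6 - 1 / x / 2) =
        6.376 / 3 * k - (1.9943 + 1 / 6) / 3 * x - 1 / 6 := by
      rw [← hx]
      field_simp
      ring
    have h3 : 3.11 + ε ≤ 2.1253 * k - 0.7256 * x := by
      have hxk : x * 0.37 ≤ k := by rw [← hx]; gcongr
      rcases le_total ε 1 with h1 | h1
      · norm_num at hxk ⊢
        linarith
      · have : x * 1 ≤ k := by rw [← hx]; gcongr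
        norm_num at this ⊢
        linarith
    rw [h2] at h1
    norm_num at h1 h3 hlog ⊢
    linarith

/-- Logarithmic form of the moment bound at a moment of order `m ≈ 4k / (3ε)`. -/
theorem log_moment_bound_le {k ε x m L : ℝ} (hk : 40 ≤ k) (hε : 0 < ε) (hx : x * ε = k)
    (hL : L = Real.log k) (hA : 0 ≤ (1 + ε) * Real.log ε + ε * L)
    (hB : (1 + 2 * ε) * L ≤ 1 + k * Real.log 2) (hm : 4 * x / 3 ≤ m) (hm' : m ≤ 4 * x / 3 + 1) :
    k * Real.log (m + 1) + (1 + Real.log m / 2 + m * Real.log m - m) -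
      m * ((1 + 2 * ε) * L - 1) ≤ -(k * L) - (k + x) * Real.log ε := by
  have hx0 : 0 < x := by
    by_contra! h
    nlinarith
  have hm0 : 0 < m := by linarith
  have hL' : 3.688 ≤ L := hL ▸ log_forty_gt.le.trans (Real.log_le_log (by norm_num) hk)
  have key := one_add_half_log_add_le hk hε hx hL' hA hB hm hm'
  have hlx : Real.log x = L - Real.log ε := by
    rw [hL, ← hx, Real.log_mul hx0.ne' hε.ne']
    ring
  set u := (m - x) / x with hu
  have hu0 : 0 ≤ u := div_nonneg (by linarith) hx0.le
  have hmu : m = x * (1 + u) := by rw [hu]; field_simp; ring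
  have hlm : Real.log m = L - Real.log ε + Real.log (1 + u) := by
    rw [hmu, Real.log_mul hx0.ne' (by linarith), hlx]
  have h1 : k * Real.log (m + 1) ≤ k * Real.log m + ε := by
    have h := Real.log_le_sub_one_of_pos (x := (m + 1) / m) (by positivity)
    rw [Real.log_div (by linarith) hm0.ne'] at h
    have h' : k * (Real.log (m + 1) - Real.log m) ≤ k * ((m + 1) / m - 1) := by gcongr
    have h'' : k * ((m + 1) / m - 1) ≤ ε := by
      have : k * ((m + 1) / m - 1) = k / m := by field_simp; ring
      rw [this, div_le_iff₀ hm0, ← hx]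
      nlinarith
    linarith
  -- The `m` part of `k + m` gives (m - x)(1 + u/2); the `k` part gives at most (m - x)ε, since u +
  -- 2 ≤ 2(1 + u).
  have h2 : (k + m) * Real.log (1 + u) ≤ (m - x) * (1 + u / 2 + ε) := by
    calc (k + m) * Real.log (1 + u) ≤ (k + m) * (u * (u + 2) / (2 * (1 + u))) := by
          gcongr
          exact log_one_add_le hu0
      _ ≤ (m - x) * (1 + u / 2 + ε) := by
          rw [mul_div_assoc', div_le_iff₀ (by positivity), ← hx, hmu]
          have : 0 ≤ x * ε * u * u := by positivity
          nlinarith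
  have h3 : (k + m) * Real.log m - m * ((1 + 2 * ε) * L) = -(k * L) - (k + x) * Real.log ε +
      ((k + m) * Real.log (1 + u) - (m - x) * (2 * ε * L + Real.log ε)) := by
    rw [hlm, ← hx]
    ring
  linarith

theorem moment_bound_le {k : ℕ} (hk : 40 ≤ k) {ε : ℝ} (hε : 0 < ε)
    (hA : 1 ≤ ε ^ (1 + 1 / ε) * (k : ℝ))
    (hB : (k : ℝ) ^ (1 + 2 * ε) * (2 : ℝ)⁻¹ ^ k / Real.exp 1 ≤ 1) :
    ∃ m : ℕ, (m + 1 : ℝ) ^ k * m.factorial /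
      (2 ^ k * ((k : ℝ) ^ (1 + 2 * ε) * (2 : ℝ)⁻¹ ^ k / Real.exp 1)) ^ m ≤
        (1 / (ε ^ (1 + 1 / ε) * (k : ℝ))) ^ k := by
  have hk' : (40 : ℝ) ≤ k := by exact_mod_cast hk
  have hk0 : (0 : ℝ) < k := by linarith
  have hx : (k / ε : ℝ) * ε = k := div_mul_cancel₀ _ hε.ne'
  have hx0 : 0 < (k / ε : ℝ) := by positivity
  -- At m = k/ε the leading terms equal the claimed bound exactly, with the 1/e of the threshold
  -- cancelling Stirling's e^(-m). Overshooting by a third gains enough to absorb the lower order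
  -- terms.
  refine ⟨⌈4 * (k / ε : ℝ) / 3⌉₊, ?_⟩
  set m := ⌈4 * (k / ε : ℝ) / 3⌉₊ with hm
  have hm1 : 4 * (k / ε : ℝ) / 3 ≤ m := Nat.le_ceil _
  have hm2 : (m : ℝ) ≤ 4 * (k / ε : ℝ) / 3 + 1 := (Nat.ceil_lt_add_one (by positivity)).le
  have hm0 : m ≠ 0 := by
    have : (0 : ℝ) < m := by linarith
    exact_mod_cast this.ne'
  have hA' : 0 ≤ (1 + ε) * Real.log ε + ε * Real.log k := by
    have h := Real.log_nonneg hA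
    rw [Real.log_mul (by positivity) hk0.ne', Real.log_rpow hε] at h
    have h' := mul_nonneg hε.le h
    have e : ε * ((1 + 1 / ε) * Real.log ε + Real.log k) =
        (1 + ε) * Real.log ε + ε * Real.log k := by
      field_simp
      ring
    rwa [e] at h'
  have hB' : (1 + 2 * ε) * Real.log k ≤ 1 + k * Real.log 2 := by
    have h := Real.log_nonpos (by positivity) hB
    rw [Real.log_div (by positivity) (by positivity), Real.log_mul (by positivity) (by positivity),
      Real.log_rpow hk0, Real.log_pow, Real.log_inv, Real.log_exp] at h
    linarith
  have key := log_moment_bound_le hk' hε hx rfl hA' hB' hm1 hm2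
  have hfac := log_factorial_le hm0
  have e1 : (2 : ℝ) ^ k * ((k : ℝ) ^ (1 + 2 * ε) * (2 : ℝ)⁻¹ ^ k / Real.exp 1) =
      (k : ℝ) ^ (1 + 2 * ε) / Real.exp 1 := by
    rw [inv_pow]
    field_simp
  rw [e1, ← Real.log_le_log_iff (by positivity) (by positivity),
    Real.log_div (by positivity) (by positivity), Real.log_mul (by positivity) (by positivity),
    Real.log_pow, Real.log_pow, Real.log_pow, Real.log_div (by positivity) (by positivity),
    Real.log_rpow hk0, Real.log_exp, Real.log_div one_ne_zero (by positivity), Real.log_one,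
    Real.log_mul (by positivity) hk0.ne', Real.log_rpow hε]
  have e2 : (k : ℝ) * (0 - ((1 + 1 / ε) * Real.log ε + Real.log k)) =
      -(k * Real.log k) - (k + k / ε) * Real.log ε := by
    field_simp
    ring
  rw [e2]
  linarith

/-! ### Asymptotics of the bound and conclusion. -/

theorem isEquivalent_log_bound {c : ℝ} (hc : 0 < c) :
    Asymptotics.IsEquivalent Filter.atTop
      (fun k : ℕ => Real.log ((1 / (c * (k : ℝ))) ^ k))
      (fun k : ℕ => -((k : ℝ) * Real.log (k : ℝ))) := by
  have hlog : Filter.Tendsto (fun k : ℕ => Real.log k) Filter.atTop Filter.atTop :=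
    Real.tendsto_log_atTop.comp tendsto_natCast_atTop_atTop
  have h1 : (fun _ : ℕ => Real.log c) =o[Filter.atTop] fun k : ℕ => Real.log k :=
    Asymptotics.isLittleO_const_left.2 (Or.inr (tendsto_norm_atTop_atTop.comp hlog))
  have h2 := ((Asymptotics.isBigO_refl (fun k : ℕ => (k : ℝ)) Filter.atTop).mul_isLittleO
    h1).neg_left.neg_right
  refine Asymptotics.IsLittleO.congr' h2 ?_ .rfl
  filter_upwards [Filter.eventually_gt_atTop 0] with k hk
  have hk0 : (k : ℝ) ≠ 0 := by positivity
  rw [Pi.sub_apply, Real.log_pow, Real.log_div one_ne_zero (by positivity), Real.log_one,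
    Real.log_mul hc.ne' hk0]
  ring

theorem overlap_le_one {k : ℕ} (φ ψ : PureState k) : overlap φ ψ ≤ 1 := by
  have h := norm_inner_le_norm (𝕜 := ℂ) (φ : QubitSpace k) (ψ : QubitSpace k)
  rw [norm_eq_of_mem_sphere φ, norm_eq_of_mem_sphere ψ, mul_one] at h
  exact pow_le_one₀ (norm_nonneg _) h

theorem mainTheorem9 (ε : ℝ) (hε : 0 < ε) :
    (∀ k : ℕ, 40 ≤ k →
      (randomPureState k).real
          {ψ : PureState k | ∃ φ : PureState k, IsProductState φ ∧
            (k : ℝ) ^ (1 + 2 * ε) * (2 : ℝ)⁻¹ ^ k / Real.exp 1 ≤ overlap φ ψ} ≤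
        (1 / (ε ^ (1 + 1 / ε) * (k : ℝ))) ^ k) ∧
    Asymptotics.IsEquivalent Filter.atTop
      (fun k : ℕ => Real.log ((1 / (ε ^ (1 + 1 / ε) * (k : ℝ))) ^ k))
      (fun k : ℕ => -((k : ℝ) * Real.log (k : ℝ))) := by
  refine ⟨fun k hk => ?_, isEquivalent_log_bound (Real.rpow_pos_of_pos hε _)⟩
  have hk0 : (0 : ℝ) < k := by exact_mod_cast (by omega : 0 < k)
  -- In the first case the right-hand side is at least 1.
  rcases le_total (ε ^ (1 + 1 / ε) * (k : ℝ)) 1 with hA | hA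
  · exact measureReal_le_one.trans
      (one_le_pow₀ ((one_le_div (by positivity)).2 hA))
  -- A threshold above 1 exceeds every overlap, so the event is empty.
  rcases le_or_gt ((k : ℝ) ^ (1 + 2 * ε) * (2 : ℝ)⁻¹ ^ k / Real.exp 1) 1 with hB | hB
  · obtain ⟨m, hm⟩ := moment_bound_le hk hε hA hB
    exact (randomPureState_real_exists_overlap_ge_le k m (by positivity)).trans hm
  · have hempty : {ψ : PureState k | ∃ φ : PureState k, IsProductState φ ∧
        (k : ℝ) ^ (1 + 2 * ε) * (2 : ℝ)⁻¹ ^ k / Real.exp 1 ≤ overlap φ ψ} = ∅ :=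
      Set.eq_empty_of_forall_notMem fun ψ ⟨φ, _, h⟩ =>
        absurd (h.trans (overlap_le_one φ ψ)) (not_le.2 hB)
    rw [hempty, measureReal_empty]
    positivity
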